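/- Let $\Gamma$ be a (discrete) group and let $\mathrm{Amen}$ be the family of all amenable subgroups of $\Gamma$. Then $\mathrm{Amen}$ is strongly $H_b^*$-admissible, in the following sense. For a family $F$ of subgroups of $\Gamma$ (closed under conjugation and under taking subgroups), a model for $E_F\Gamma$ is a $\Gamma$-CW-complex $X$, all of whose isotropy groups lie in $F$, such that every $\Gamma$-CW-complex $Y$ all of whose isotropy groups lie in $F$ admits, up to $\Gamma$-homotopy, exactly one continuous $\Gamma$-map $Y \to X$; $E\Gamma$ denotes a model for the family consisting of the trivial subgroup only. For a topological space $X$, let $C_b^*(X;\mathbb{R})$ be the topological dual of the singular chain complex $C_*(X;\mathbb{R})$ with the $\ell^1$-norm given by the basis of singular simplices; if $\Gamma$ acts on $X$ by homeomorphisms, let $C_b^*(X;\mathbb{R})^\Gamma$ be the subcomplex of $\Gamma$-invariant bounded cochains. Then for all models $E\Gamma$ and $E_{\mathrm{Amen}}\Gamma$, for every continuous $\Gamma$-map $f\colon E\Gamma \to E_{\mathrm{Amen}}\Gamma$ (which is unique up to $\Gamma$-homotopy), and for every $n \ge 0$, the induced map $$H^n\bigl(C_b^*(f;\mathbb{R})^\Gamma\bigr)\colon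 H^n\bigl(C_b^*(E_{\mathrm{Amen}}\Gamma;\mathbb{R})^\Gamma\bigr) \longrightarrow H^n\bigl(C_b^*(E\Gamma;\mathbb{R})^\Gamma\bigr)$$ is bijective. -/

import Mathlib

noncomputable section

namespace BddCoh

universe u

/-! ### Amenable groups -/

/-- The real vector space of bounded real-valued functions on a set. -/
def BoundedFun (S : Type*) : Submodule ℝ (S → ℝ) where
  carrier := {f | ∃ C : ℝ, ∀ s, |f s| ≤ C}
  zero_mem' := ⟨0, fun s => by simp⟩
  add_mem' := by
    rintro f g ⟨C, hC⟩ ⟨D, hD⟩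
    exact ⟨C + D, fun s => (abs_add_le _ _).trans (add_le_add (hC s) (hD s))⟩
  smul_mem' := by
    rintro a f ⟨C, hC⟩
    refine ⟨|a| * C, fun s => ?_⟩
    simp only [Pi.smul_apply, smul_eq_mul, abs_mul]
    exact mul_le_mul_of_nonneg_left (hC s) (abs_nonneg a)

/-- Precomposition of bounded functions with a map of sets. -/
def BoundedFun.comp {S T : Type*} (r : S → T) : BoundedFun T →ₗ[ℝ] BoundedFun S where
  toFun f := ⟨fun s => f.1 (r s), f.2.imp fun _ hC s => hC (r s)⟩
  map_add' _ _ := rfl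
  map_smul' _ _ := rfl

/-- The constant function `1`. -/
def BoundedFun.one (S : Type*) : BoundedFun S := ⟨fun _ => 1, 1, fun _ => by simp⟩

/-- A (discrete) group is amenable if there is a left-invariant mean on the space of bounded
real-valued functions on it. -/
def IsAmenable (G : Type*) [Group G] : Prop :=
  ∃ m : BoundedFun G →ₗ[ℝ] ℝ,
    m (BoundedFun.one G) = 1 ∧
    (∀ f : BoundedFun G, (∀ x, 0 ≤ f.1 x) → 0 ≤ m f) ∧
    ∀ (g : G) (f : BoundedFun G), m (BoundedFun.comp (fun x => g * x) f) = m f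

/-- Amenability passes to groups that embed into an amenable group. -/
theorem IsAmenable.of_injective {G H : Type*} [Group G] [Group H] (φ : H →* G)
    (hφ : Function.Injective φ) (hG : IsAmenable G) : IsAmenable H := by
  obtain ⟨m, m1, mpos, minv⟩ := hG
  let R := QuotientGroup.rightRel φ.range
  have key : ∀ g : G, ∃ h : H, φ h * (Quotient.mk R g).out = g := by
    intro g
    have h1 : R ((Quotient.mk R g).out) g := Quotient.exact (Quotient.out_eq _)
    rw [QuotientGroup.rightRel_apply] at h1
    obtain ⟨h, hh⟩ := h1
    exact ⟨h, by rw [hh]; group⟩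
  choose r hr using key
  have hreq : ∀ (k : H) (g : G), r (φ k * g) = k * r g := by
    intro k g
    have h1 : Quotient.mk R (φ k * g) = Quotient.mk R g := by
      apply Quotient.sound
      change R _ _
      rw [QuotientGroup.rightRel_apply]
      exact ⟨k⁻¹, by simp⟩
    have h2 := hr (φ k * g)
    rw [h1] at h2
    apply hφ
    apply mul_right_cancel (b := (Quotient.mk R g).out)
    rw [h2, map_mul, mul_assoc, hr]
  refine ⟨m ∘ₗ BoundedFun.comp r, m1, fun f hf => mpos _ fun x => hf _, fun k f => ?_⟩
  refine Eq.trans (congrArg m ?_) (minv (φ k) (BoundedFun.comp r f))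
  apply Subtype.ext
  funext g
  exact congrArg f.1 (hreq k g).symm

/-! ### Families of subgroups -/

/-- A subgroup family: a set of subgroups closed under conjugation and under taking subgroups. -/
structure SubgroupFamily (Γ : Type*) [Group Γ] where
  carrier : Set (Subgroup Γ)
  conj_mem : ∀ H ∈ carrier, ∀ γ : Γ, H.map (MulAut.conj γ).toMonoidHom ∈ carrier
  subgroup_mem : ∀ H ∈ carrier, ∀ K : Subgroup Γ, K ≤ H → K ∈ carrier

/-- The family consisting only of the trivial subgroup. -/
def trivialFamily (Γ : Type*) [Group Γ] : SubgroupFamily Γ where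
  carrier := {⊥}
  conj_mem := by
    rintro H rfl γ
    simp
  subgroup_mem := by
    rintro H rfl K hK
    simpa using hK

/-- The family of all amenable subgroups. -/
def amenableFamily (Γ : Type*) [Group Γ] : SubgroupFamily Γ where
  carrier := {H | IsAmenable H}
  conj_mem := fun H hH γ =>
    IsAmenable.of_injective
      (H.equivMapOfInjective (MulAut.conj γ).toMonoidHom (MulAut.conj γ).injective).symm.toMonoidHom
      (MulEquiv.injective _) hH
  subgroup_mem := fun _ hH _ hK =>
    IsAmenable.of_injective (Subgroup.inclusion hK) (Subgroup.inclusion_injective hK) hH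

/-! ### Equivariant CW-complexes and classifying spaces -/

/-- `X` is a `Γ`-CW-complex for the discrete group `Γ`: `X` is a (Hausdorff) CW-complex on which
`Γ` acts by homeomorphisms, permuting the open `n`-cells for each `n`, such that a group element
that maps an open cell to itself fixes this cell pointwise. -/
def IsGammaCW (Γ : Type*) [Group Γ] (X : Type u) [TopologicalSpace X] [MulAction Γ X] : Prop :=
  ContinuousConstSMul Γ X ∧ T2Space X ∧
  ∃ _ : Topology.CWComplex (Set.univ : Set X),
    (∀ (γ : Γ) (n : ℕ) (i : Topology.RelCWComplex.cell (Set.univ : Set X) n),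
      ∃ j : Topology.RelCWComplex.cell (Set.univ : Set X) n,
        (fun x => γ • x) '' Topology.RelCWComplex.openCell n i =
          Topology.RelCWComplex.openCell n j) ∧
    ∀ (γ : Γ) (n : ℕ) (i : Topology.RelCWComplex.cell (Set.univ : Set X) n),
      (fun x => γ • x) '' Topology.RelCWComplex.openCell n i =
          Topology.RelCWComplex.openCell n i →
        ∀ x ∈ Topology.RelCWComplex.openCell n i, γ • x = x

/-- All isotropy groups of the `Γ`-set `X` lie in the family `F`. -/
def HasRestrictedIsotropy {Γ : Type*} [Group Γ] (F : SubgroupFamily Γ) (X : Type*)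
    [MulAction Γ X] : Prop :=
  ∀ x : X, MulAction.stabilizer Γ x ∈ F.carrier

/-- The continuous map `f` is a `Γ`-map. -/
def IsEquivariant (Γ : Type*) [Group Γ] {X Y : Type*} [TopologicalSpace X] [TopologicalSpace Y]
    [MulAction Γ X] [MulAction Γ Y] (f : C(X, Y)) : Prop :=
  ∀ (γ : Γ) (x : X), f (γ • x) = γ • f x

/-- Two continuous maps are `Γ`-homotopic: they are homotopic through `Γ`-maps. -/
def GammaHomotopic (Γ : Type*) [Group Γ] {X Y : Type*} [TopologicalSpace X] [TopologicalSpace Y]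
    [MulAction Γ X] [MulAction Γ Y] (f g : C(X, Y)) : Prop :=
  ContinuousMap.HomotopicWith f g (IsEquivariant Γ)

/-- `X` is a model for the classifying space `E_F Γ`: it is a `Γ`-CW-complex with `F`-restricted
isotropy, and every `Γ`-CW-complex `Y` with `F`-restricted isotropy admits, up to `Γ`-homotopy,
exactly one continuous `Γ`-map to `X`. -/
def IsClassifyingSpace {Γ : Type u} [Group Γ] (F : SubgroupFamily Γ) (X : Type u)
    [TopologicalSpace X] [MulAction Γ X] : Prop :=
  IsGammaCW Γ X ∧ HasRestrictedIsotropy F X ∧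
  ∀ (Y : Type u) [TopologicalSpace Y] [MulAction Γ Y],
    IsGammaCW Γ Y → HasRestrictedIsotropy F Y →
      (∃ f : C(Y, X), IsEquivariant Γ f) ∧
      ∀ f g : C(Y, X), IsEquivariant Γ f → IsEquivariant Γ g → GammaHomotopic Γ f g

/-! ### The normed singular chain complex -/

/-- Singular `n`-simplices of `X`. -/
abbrev SingularSimplex (X : Type u) [TopologicalSpace X] (n : ℕ) : Type u :=
  C(stdSimplex ℝ (Fin (n + 1)), X)

/-- The `i`-th face of a singular simplex. -/
def SingularSimplex.face {X : Type u} [TopologicalSpace X] {n : ℕ} (i : Fin (n + 2))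
    (σ : SingularSimplex X (n + 1)) : SingularSimplex X n :=
  σ.comp ⟨stdSimplex.map i.succAbove, stdSimplex.continuous_map _⟩

/-- Real singular `n`-chains of `X`. -/
def SingularChain (X : Type u) [TopologicalSpace X] (n : ℕ) : Type u :=
  SingularSimplex X n →₀ ℝ

namespace SingularChain

variable {X Y : Type u} [TopologicalSpace X] [TopologicalSpace Y] {n : ℕ}

instance : AddCommGroup (SingularChain X n) :=
  inferInstanceAs (AddCommGroup (SingularSimplex X n →₀ ℝ))

instance : Module ℝ (SingularChain X n) :=
  inferInstanceAs (Module ℝ (SingularSimplex X n →₀ ℝ))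

/-- The `ℓ¹`-norm with respect to the basis of singular simplices. -/
instance : Norm (SingularChain X n) :=
  ⟨fun c => Finsupp.sum (M := ℝ) c fun _ a => |a|⟩

theorem norm_def (c : SingularChain X n) :
    ‖c‖ = Finsupp.sum (M := ℝ) c fun _ a => |a| := rfl

theorem normCore : NormedSpace.Core ℝ (SingularChain X n) where
  norm_nonneg c := Finset.sum_nonneg fun _ _ => abs_nonneg _
  norm_smul a c := by
    have h : ∀ e : SingularSimplex X n →₀ ℝ,
        (a • e).sum (fun _ b => |b|) = |a| * e.sum fun _ b => |b| := fun e => by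
      rw [Finsupp.sum_smul_index (by simp), Finsupp.mul_sum]
      simp only [abs_mul]
    exact h c
  norm_triangle c d := by
    classical
    have h : ∀ e : SingularSimplex X n →₀ ℝ,
        e.support ⊆ Finsupp.support (M := ℝ) c ∪ Finsupp.support (M := ℝ) d →
        Finsupp.sum e (fun _ a => |a|) =
          ∑ σ ∈ Finsupp.support (M := ℝ) c ∪ Finsupp.support (M := ℝ) d, |e σ| :=
      fun e he => Finsupp.sum_of_support_subset e he _ (by simp)
    rw [norm_def, norm_def, norm_def, h c Finset.subset_union_left,
      h d Finset.subset_union_right, h (c + d) Finsupp.support_add, ← Finset.sum_add_distrib]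
    exact Finset.sum_le_sum fun _ _ => abs_add_le _ _
  norm_eq_zero_iff c := by
    constructor
    · intro h
      have h1 := (Finset.sum_eq_zero_iff_of_nonneg fun _ _ => abs_nonneg _).1 h
      refine Finsupp.ext (M := ℝ) fun σ => ?_
      by_cases hσ : σ ∈ Finsupp.support (M := ℝ) c
      · exact abs_eq_zero.1 (h1 σ hσ)
      · exact Finsupp.notMem_support_iff.1 hσ
    · rintro rfl
      exact Finsupp.sum_zero_index

instance : NormedAddCommGroup (SingularChain X n) := NormedAddCommGroup.ofCore normCore

instance : NormedSpace ℝ (SingularChain X n) := NormedSpace.ofCore normCore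

/-- The basis element given by a singular simplex. -/
def simplex (σ : SingularSimplex X n) : SingularChain X n := Finsupp.single σ (1 : ℝ)

theorem norm_simplex (σ : SingularSimplex X n) : ‖simplex σ‖ = 1 := by
  rw [norm_def, simplex, Finsupp.sum_single_index] <;> simp

/-- The linear extension of a map that is defined on singular simplices. -/
def lift {V : Type*} [AddCommGroup V] [Module ℝ V] (v : SingularSimplex X n → V) :
    SingularChain X n →ₗ[ℝ] V :=
  Finsupp.linearCombination ℝ v

theorem lift_simplex {V : Type*} [AddCommGroup V] [Module ℝ V] (v : SingularSimplex X n → V)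
    (σ : SingularSimplex X n) : lift v (simplex σ) = v σ :=
  (Finsupp.linearCombination_single ℝ 1 σ).trans (one_smul ℝ _)

theorem norm_lift_le {V : Type*} [NormedAddCommGroup V] [NormedSpace ℝ V]
    (v : SingularSimplex X n → V) (K : ℝ) (hK : ∀ σ, ‖v σ‖ ≤ K) (c : SingularChain X n) :
    ‖lift v c‖ ≤ K * ‖c‖ := by
  have h : ∀ e : SingularSimplex X n →₀ ℝ,
      ‖Finsupp.linearCombination ℝ v e‖ ≤ K * e.sum fun _ a => |a| := fun e => by
    rw [Finsupp.linearCombination_apply, Finsupp.mul_sum]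
    refine (norm_sum_le _ _).trans (Finset.sum_le_sum fun σ _ => ?_)
    rw [norm_smul, mul_comm, Real.norm_eq_abs]
    exact mul_le_mul_of_nonneg_right (hK σ) (abs_nonneg _)
  exact h c

theorem hom_ext {V : Type*} [NormedAddCommGroup V] [NormedSpace ℝ V]
    {T S : SingularChain X n →L[ℝ] V} (h : ∀ σ, T (simplex σ) = S (simplex σ)) : T = S := by
  apply ContinuousLinearMap.coe_injective
  refine Finsupp.lhom_ext' fun σ => LinearMap.ext_ring ?_
  exact h σ

/-- The boundary operator `∂σ = ∑ᵢ (-1)ⁱ (i-th face of σ)`, a bounded linear map. -/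
def boundary (X : Type u) [TopologicalSpace X] (n : ℕ) :
    SingularChain X (n + 1) →L[ℝ] SingularChain X n :=
  (lift fun σ => ∑ i : Fin (n + 2), (-1 : ℝ) ^ (i : ℕ) • simplex (σ.face i)).mkContinuous (n + 2)
    (norm_lift_le _ _ fun σ => (norm_sum_le _ _).trans (by simp [norm_smul, norm_simplex]))

theorem boundary_simplex (σ : SingularSimplex X (n + 1)) :
    boundary X n (simplex σ) =
      ∑ i : Fin (n + 2), (-1 : ℝ) ^ (i : ℕ) • simplex (σ.face i) :=
  lift_simplex _ σ

/-- The chain map induced by a continuous map, a bounded linear map. -/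
def map (f : C(X, Y)) (n : ℕ) : SingularChain X n →L[ℝ] SingularChain Y n :=
  (lift fun σ => simplex (f.comp σ)).mkContinuous 1
    (norm_lift_le _ _ fun _ => (norm_simplex _).le)

theorem map_simplex (f : C(X, Y)) (σ : SingularSimplex X n) :
    map f n (simplex σ) = simplex (f.comp σ) :=
  lift_simplex _ σ

theorem map_comp_boundary (f : C(X, Y)) (n : ℕ) :
    (map f n).comp (boundary X n) = (boundary Y n).comp (map f (n + 1)) := by
  refine hom_ext fun σ => ?_
  simp only [ContinuousLinearMap.comp_apply, boundary_simplex, map_simplex, map_sum, map_smul]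
  rfl

theorem face_face (σ : SingularSimplex X (n + 2)) {i j : Fin (n + 2)} (h : i ≤ j) :
    (σ.face j.succ).face i = (σ.face i.castSucc).face j := by
  ext x
  simp only [SingularSimplex.face, ContinuousMap.comp_apply, ContinuousMap.coe_mk,
    stdSimplex.map_comp_apply]
  congr 2
  funext k
  exact DFunLike.congr_fun (congrArg SimplexCategory.Hom.toOrderHom
    (SimplexCategory.δ_comp_δ h)) k

theorem boundary_comp_boundary (X : Type u) [TopologicalSpace X] (n : ℕ) :
    (boundary X n).comp (boundary X (n + 1)) = 0 := by
  refine hom_ext fun σ => ?_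
  simp only [ContinuousLinearMap.comp_apply, boundary_simplex, map_sum, map_smul,
    Finset.smul_sum, zero_apply, smul_smul, ← pow_add]
  rw [← Finset.sum_product', Finset.univ_product_univ]
  let S : Finset (Fin (n + 3) × Fin (n + 2)) := {p | (p.1 : ℕ) ≤ (p.2 : ℕ)}
  rw [← Finset.sum_add_sum_compl S, ← eq_neg_iff_add_eq_zero, ← Finset.sum_neg_distrib]
  refine Finset.sum_bij
    (fun p hp => (p.2.succ, Fin.castLT p.1
      (lt_of_le_of_lt (Finset.mem_filter.mp hp).right p.2.is_lt))) ?_ ?_ ?_ ?_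
  · intro p hp
    simp_rw [S, Finset.compl_filter, Finset.mem_filter_univ, Fin.val_succ,
      Fin.val_castLT] at hp ⊢
    lia
  · rintro ⟨i, j⟩ hp ⟨i', j'⟩ hp' h
    simp only [Prod.mk.injEq, Fin.ext_iff, Fin.val_castLT] at h ⊢
    exact ⟨h.2, by simpa [Fin.ext_iff] using h.1⟩
  · rintro ⟨i, j⟩ hp
    simp_rw [S, Finset.compl_filter, Finset.mem_filter_univ, not_le] at hp
    refine ⟨(j.castSucc, i.pred ?_), ?_, ?_⟩
    · rintro rfl
      simp at hp
    · simp only [S, Finset.mem_filter_univ, Fin.val_castSucc, Fin.val_pred]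
      lia
    · simp
  · rintro ⟨i, j⟩ hp
    have hij : (i : ℕ) ≤ (j : ℕ) := (Finset.mem_filter.mp hp).right
    have h := face_face σ (i := Fin.castLT i (lt_of_le_of_lt hij j.is_lt)) (j := j) hij
    rw [Fin.castSucc_castLT] at h
    simp only [h, Fin.val_succ, Fin.val_castLT, ← neg_smul]
    congr 1
    ring

end SingularChain

/-! ### Bounded cochains and bounded cohomology -/

/-- Bounded `n`-cochains: the topological dual of the `ℓ¹`-normed space of singular chains. -/
abbrev BoundedCochain (X : Type u) [TopologicalSpace X] (n : ℕ) : Type u :=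
  StrongDual ℝ (SingularChain X n)

section Invariants

variable (Γ : Type u) [Group Γ] {X Y : Type u} [TopologicalSpace X] [TopologicalSpace Y]
  [MulAction Γ X] [MulAction Γ Y] [ContinuousConstSMul Γ X] [ContinuousConstSMul Γ Y]

/-- The action of a group element as a continuous map. -/
def smulMap (X : Type u) [TopologicalSpace X] [MulAction Γ X] [ContinuousConstSMul Γ X] (γ : Γ) :
    C(X, X) :=
  ⟨fun x => γ • x, continuous_const_smul γ⟩

/-- The `Γ`-invariant bounded cochains. -/
def invariantCochains (X : Type u) [TopologicalSpace X] [MulAction Γ X]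
    [ContinuousConstSMul Γ X] (n : ℕ) : Submodule ℝ (BoundedCochain X n) where
  carrier := {φ | ∀ γ : Γ, φ.comp (SingularChain.map (smulMap Γ X γ) n) = φ}
  zero_mem' := fun γ => by simp
  add_mem' := fun ha hb γ => by rw [ContinuousLinearMap.add_comp, ha γ, hb γ]
  smul_mem' := fun a φ h γ => by rw [ContinuousLinearMap.smul_comp, h γ]

/-- The coboundary operator `φ ↦ φ ∘ ∂` on `Γ`-invariant bounded cochains. -/
def coboundary (X : Type u) [TopologicalSpace X] [MulAction Γ X]
    [ContinuousConstSMul Γ X] (n : ℕ) :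
    invariantCochains Γ X n →ₗ[ℝ] invariantCochains Γ X (n + 1) where
  toFun φ := ⟨φ.1.comp (SingularChain.boundary X n), fun γ => by
    rw [ContinuousLinearMap.comp_assoc, ← SingularChain.map_comp_boundary,
      ← ContinuousLinearMap.comp_assoc, φ.2 γ]⟩
  map_add' _ _ := rfl
  map_smul' _ _ := rfl

/-- The cochain complex `C_b^*(X; ℝ)^Γ` of `Γ`-invariant bounded cochains. -/
def invariantComplex (X : Type u) [TopologicalSpace X] [MulAction Γ X]
    [ContinuousConstSMul Γ X] : CochainComplex (ModuleCat.{u} ℝ) ℕ :=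
  CochainComplex.of (fun n => ModuleCat.of ℝ (invariantCochains Γ X n))
    (fun n => ModuleCat.ofHom (coboundary Γ X n))
    (fun n => by
      ext φ : 2
      apply Subtype.ext
      change (φ.1.comp (SingularChain.boundary X n)).comp (SingularChain.boundary X (n + 1)) = 0
      rw [ContinuousLinearMap.comp_assoc, SingularChain.boundary_comp_boundary,
        ContinuousLinearMap.comp_zero])

theorem invariantComplex_d (X : Type u) [TopologicalSpace X] [MulAction Γ X]
    [ContinuousConstSMul Γ X] (n : ℕ) :
    (invariantComplex Γ X).d n (n + 1) = ModuleCat.ofHom (coboundary Γ X n) :=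
  CochainComplex.of_d (fun n => ModuleCat.of ℝ (invariantCochains Γ X n))
    (fun n => ModuleCat.ofHom (coboundary Γ X n)) n

variable {Γ}

/-- Pullback of `Γ`-invariant bounded cochains along a continuous `Γ`-map. -/
def pullback (f : C(X, Y)) (hf : IsEquivariant Γ f) (n : ℕ) :
    invariantCochains Γ Y n →ₗ[ℝ] invariantCochains Γ X n where
  toFun φ := ⟨φ.1.comp (SingularChain.map f n), fun γ => by
    have h : (SingularChain.map f n).comp (SingularChain.map (smulMap Γ X γ) n) =
        (SingularChain.map (smulMap Γ Y γ) n).comp (SingularChain.map f n) := by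
      refine SingularChain.hom_ext fun σ => ?_
      simp only [ContinuousLinearMap.comp_apply, SingularChain.map_simplex]
      congr 1
      ext x
      exact hf γ (σ x)
    rw [ContinuousLinearMap.comp_assoc, h, ← ContinuousLinearMap.comp_assoc, φ.2 γ]⟩
  map_add' _ _ := rfl
  map_smul' _ _ := rfl

/-- The cochain map `C_b^*(f; ℝ)^Γ` induced by a continuous `Γ`-map `f`. -/
def pullbackMap (f : C(X, Y)) (hf : IsEquivariant Γ f) :
    invariantComplex Γ Y ⟶ invariantComplex Γ X :=
  CochainComplex.ofHom (fun n => ModuleCat.ofHom (pullback f hf n)) (fun n => by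
    rw [invariantComplex_d, invariantComplex_d]
    ext φ : 2
    apply Subtype.ext
    change (φ.1.comp (SingularChain.map f n)).comp (SingularChain.boundary X n) =
      (φ.1.comp (SingularChain.boundary Y n)).comp (SingularChain.map f (n + 1))
    rw [ContinuousLinearMap.comp_assoc, SingularChain.map_comp_boundary,
      ContinuousLinearMap.comp_assoc])

end Invariants

/-- The family `F` is strongly `H_b^*`-admissible: for (all choices of) models `E` of `EΓ` and `E'`
of `E_F Γ` and the canonical `Γ`-map `f : E → E'`, the induced map
`H^n(C_b^*(E')^Γ) → H^n(C_b^*(E)^Γ)` is bijective for every `n`. -/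
def IsStronglyAdmissible {Γ : Type u} [Group Γ] (F : SubgroupFamily Γ) : Prop :=
  ∀ (E E' : Type u) [TopologicalSpace E] [TopologicalSpace E'] [MulAction Γ E] [MulAction Γ E']
    [ContinuousConstSMul Γ E] [ContinuousConstSMul Γ E'],
    IsClassifyingSpace (trivialFamily Γ) E → IsClassifyingSpace F E' →
      ∀ (f : C(E, E')) (hf : IsEquivariant Γ f) (n : ℕ),
        Function.Bijective (HomologicalComplex.homologyMap (pullbackMap f hf) n)

end BddCoh

end

/-! Both classifying spaces are contractible once the action is forgotten, and the stabilizers of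
their singular simplices are amenable. The first fact makes the augmented bounded cochain complexes
acyclic through bounded, non-equivariant operators. The second makes them relatively injective. The
fundamental lemma of relative homological algebra then compares them.

Contractibility comes from the universal property applied to the free `Γ`-CW-complex `Γ × X`, with
`X` stripped of its action. `Γ`-maps `Γ × X → X` are the same as continuous maps `X → X`, so
uniqueness up to `Γ`-homotopy makes the identity homotopic to a constant
(`IsClassifyingSpace.homotopic_const`). Coning simplices along this homotopy gives the contraction
`BoundedContraction.ofHomotopy`.

Relative injectivity takes the form of averaging. Invariant means on stabilizers spread over orbits
to an equivariant family of means on `Γ`, one for each simplex `σ`. The mean at `σ` of `g ↦ T (a ∘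
g) (g⁻¹ σ)` turns a bounded operator `T` into an equivariant one, and changes nothing where `T`
already agrees with an equivariant operator (`average_apply_eq`).

Averaging the usual recursive formulas yields an equivariant cochain map opposite to the pullback
along `f`, and equivariant homotopies from both composites to the identity. Being equivariant, all
of these restrict to invariant cochains. -/

noncomputable section

namespace BddCoh

universe u

/-! ### Equivariant families of means -/

/-- A mean on the bounded functions on `Γ` for every point of the `Γ`-set `S`, depending
equivariantly on the point. -/
structure EquivariantMeans (Γ S : Type*) [Group Γ] [MulAction Γ S] where
  mean : S → BoundedFun Γ →ₗ[ℝ] ℝ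
  mean_one : ∀ s, mean s (BoundedFun.one Γ) = 1
  mean_nonneg : ∀ s (f : BoundedFun Γ), (∀ x, 0 ≤ f.1 x) → 0 ≤ mean s f
  mean_smul : ∀ (γ : Γ) (s : S) (f : BoundedFun Γ),
    mean (γ • s) f = mean s (BoundedFun.comp (fun x => γ * x) f)

namespace EquivariantMeans

variable {Γ S : Type*} [Group Γ] [MulAction Γ S]

theorem mean_const (μ : EquivariantMeans Γ S) (s : S) (f : BoundedFun Γ) (c : ℝ)
    (h : ∀ x, f.1 x = c) : μ.mean s f = c := by
  have : f = c • BoundedFun.one Γ := by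
    apply Subtype.ext
    funext x
    simp [h x, BoundedFun.one]
  rw [this, map_smul, μ.mean_one, smul_eq_mul, mul_one]

theorem mean_mono (μ : EquivariantMeans Γ S) (s : S) (f f' : BoundedFun Γ)
    (h : ∀ x, f.1 x ≤ f'.1 x) : μ.mean s f ≤ μ.mean s f' := by
  have := μ.mean_nonneg s (f' - f) fun x => sub_nonneg.2 (h x)
  rwa [map_sub, sub_nonneg] at this

/-- Positivity and normalization force a mean to have norm one; this keeps averages of bounded
operators bounded. -/
theorem abs_mean_le (μ : EquivariantMeans Γ S) (s : S) (f : BoundedFun Γ) (C : ℝ)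
    (h : ∀ x, |f.1 x| ≤ C) : |μ.mean s f| ≤ C := by
  have hc : ∀ c : ℝ, μ.mean s (c • BoundedFun.one Γ) = c := fun c =>
    μ.mean_const s _ c fun x => by simp [BoundedFun.one]
  rw [abs_le]
  constructor
  · rw [← hc (-C)]
    exact μ.mean_mono s _ _ fun x => by simpa [BoundedFun.one] using (abs_le.1 (h x)).1
  · rw [← hc C]
    exact μ.mean_mono s _ _ fun x => by simpa [BoundedFun.one] using (abs_le.1 (h x)).2

/-- A `Γ`-set with amenable stabilizers carries an equivariant family of means. -/
theorem nonempty_of_isAmenable (h : ∀ s : S, IsAmenable (MulAction.stabilizer Γ s)) :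
    Nonempty (EquivariantMeans Γ S) := by
  choose m m_one m_nonneg m_inv using h
  let rep : S → S := fun s => (Quotient.mk (MulAction.orbitRel Γ S) s).out
  have key : ∀ s, ∃ g : Γ, g • rep s = s := fun s => by
    have h1 : MulAction.orbitRel Γ S s (rep s) :=
      Setoid.symm' _ (Quotient.exact (Quotient.out_eq (Quotient.mk (MulAction.orbitRel Γ S) s)))
    exact h1
  choose t ht using key
  have rep_smul : ∀ (γ : Γ) (s : S), rep (γ • s) = rep s := fun γ s => by
    have h1 : Quotient.mk (MulAction.orbitRel Γ S) (γ • s) =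
        Quotient.mk (MulAction.orbitRel Γ S) s := Quotient.sound ⟨γ, rfl⟩
    exact congrArg Quotient.out h1
  -- A mean on the stabilizer, viewed as a mean on `Γ` concentrated there. The mean at `s` will be
  -- its left translate by `t s` from the orbit representative, so that only representatives involve
  -- a choice of mean.
  let push : ∀ s : S, BoundedFun Γ →ₗ[ℝ] ℝ := fun s =>
    m s ∘ₗ BoundedFun.comp (fun h : MulAction.stabilizer Γ s => (h : Γ))
  have push_inv : ∀ (s : S) (g : Γ), g • s = s → ∀ f : BoundedFun Γ,
      push s (BoundedFun.comp (fun x => g * x) f) = push s f := fun s g hg f =>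
    m_inv s ⟨g, hg⟩ (BoundedFun.comp (fun h : MulAction.stabilizer Γ s => (h : Γ)) f)
  refine ⟨⟨fun s => push (rep s) ∘ₗ BoundedFun.comp (fun x => t s * x),
    fun s => m_one (rep s), fun s f hf => m_nonneg (rep s) _ fun x => hf _, fun γ s f => ?_⟩⟩
  change push (rep (γ • s)) (BoundedFun.comp (fun x => t (γ • s) * x) f) =
    push (rep s) (BoundedFun.comp (fun x => t s * x) (BoundedFun.comp (fun x => γ * x) f))
  rw [rep_smul]
  -- Both `t (γ • s)` and `γ * t s` carry the representative to `γ • s`, so they differ by an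
  -- element of its stabilizer, under which the pushed mean is invariant.
  rw [← push_inv (rep s) ((t (γ • s))⁻¹ * (γ * t s))]
  · congr 1
    apply Subtype.ext
    funext x
    simp [BoundedFun.comp, mul_assoc]
  · have h1 := ht (γ • s)
    rw [rep_smul] at h1
    rw [mul_smul, inv_smul_eq_iff, h1, mul_smul, ht]

end EquivariantMeans

/-! ### Operators between spaces of bounded cochains -/

section Operators

variable {X Y Z : Type u} [TopologicalSpace X] [TopologicalSpace Y] [TopologicalSpace Z]

theorem SingularChain.norm_map_le (f : C(X, Y)) (n : ℕ) : ‖SingularChain.map f n‖ ≤ 1 :=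
  LinearMap.mkContinuous_norm_le _ zero_le_one _

theorem SingularChain.map_comp (g : C(Y, Z)) (f : C(X, Y)) (n : ℕ) :
    (map g n).comp (map f n) = map (g.comp f) n :=
  hom_ext fun σ => by simp only [ContinuousLinearMap.comp_apply, map_simplex]; rfl

/-- The bounded cochain with prescribed bounded values on the singular simplices. -/
def BoundedCochain.ofBounded {n : ℕ} (v : SingularSimplex X n → ℝ) (K : ℝ)
    (hK : ∀ σ, |v σ| ≤ K) : BoundedCochain X n :=
  (SingularChain.lift v).mkContinuous K (SingularChain.norm_lift_le v K hK)

theorem BoundedCochain.ofBounded_simplex {n : ℕ} (v : SingularSimplex X n → ℝ) (K : ℝ)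
    (hK : ∀ σ, |v σ| ≤ K) (σ : SingularSimplex X n) :
    ofBounded v K hK (SingularChain.simplex σ) = v σ :=
  SingularChain.lift_simplex v σ

/-- The coboundary operator on bounded cochains. -/
def bdCoboundary (X : Type u) [TopologicalSpace X] (n : ℕ) :
    BoundedCochain X n →L[ℝ] BoundedCochain X (n + 1) :=
  ContinuousLinearMap.precomp ℝ (SingularChain.boundary X n)

theorem bdCoboundary_apply {n : ℕ} (a : BoundedCochain X n) :
    bdCoboundary X n a = a.comp (SingularChain.boundary X n) := rfl

theorem bdCoboundary_bdCoboundary {n : ℕ} (a : BoundedCochain X n) :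
    bdCoboundary X (n + 1) (bdCoboundary X n a) = 0 := by
  rw [bdCoboundary_apply, bdCoboundary_apply, ContinuousLinearMap.comp_assoc,
    SingularChain.boundary_comp_boundary, ContinuousLinearMap.comp_zero]

/-- Pullback does not increase norms and simplices have norm one. The bound is uniform in `f` and
`σ`, so the conjugates of `T` form a bounded function on `Γ`, to which a mean applies. -/
theorem abs_apply_comp_map_le {m n : ℕ} (T : BoundedCochain X m →L[ℝ] BoundedCochain Y n)
    (σ : SingularSimplex Y n) (a : BoundedCochain X m) (f : C(X, X)) :
    |T (a.comp (SingularChain.map f m)) (SingularChain.simplex σ)| ≤ ‖T‖ * ‖a‖ := by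
  have h1 : ‖a.comp (SingularChain.map f m)‖ ≤ ‖a‖ :=
    (ContinuousLinearMap.opNorm_comp_le a _).trans
      (mul_le_of_le_one_right (norm_nonneg _) (SingularChain.norm_map_le _ _))
  have h2 := (T (a.comp (SingularChain.map f m))).le_opNorm
    (SingularChain.simplex σ)
  rw [SingularChain.norm_simplex, mul_one] at h2
  exact h2.trans ((T.le_opNorm _).trans (mul_le_mul_of_nonneg_left h1 (norm_nonneg _)))

variable (Γ : Type u) [Group Γ] [MulAction Γ X] [MulAction Γ Y] [MulAction Γ Z]
  [ContinuousConstSMul Γ X] [ContinuousConstSMul Γ Y] [ContinuousConstSMul Γ Z]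

theorem map_smulMap_mul (γ γ' : Γ) (n : ℕ) :
    (SingularChain.map (smulMap Γ X γ) n).comp (SingularChain.map (smulMap Γ X γ') n) =
      SingularChain.map (smulMap Γ X (γ * γ')) n := by
  rw [SingularChain.map_comp]
  congr 1
  ext x
  exact (mul_smul γ γ' x).symm

/-- An operator between spaces of bounded cochains that commutes with the action of `Γ`. -/
def IsEquivariantOp {m n : ℕ} (T : BoundedCochain X m →L[ℝ] BoundedCochain Y n) : Prop :=
  ∀ (γ : Γ) (a : BoundedCochain X m),
    T (a.comp (SingularChain.map (smulMap Γ X γ) m)) =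
      (T a).comp (SingularChain.map (smulMap Γ Y γ) n)

variable {Γ}

theorem isEquivariantOp_bdCoboundary (n : ℕ) : IsEquivariantOp Γ (bdCoboundary X n) := by
  intro γ a
  rw [bdCoboundary_apply, bdCoboundary_apply, ContinuousLinearMap.comp_assoc,
    SingularChain.map_comp_boundary, ContinuousLinearMap.comp_assoc]

theorem IsEquivariantOp.comp {k m n : ℕ} {T : BoundedCochain Y m →L[ℝ] BoundedCochain Z n}
    {P : BoundedCochain X k →L[ℝ] BoundedCochain Y m} (hT : IsEquivariantOp Γ T)
    (hP : IsEquivariantOp Γ P) : IsEquivariantOp Γ (T.comp P) := fun γ a => by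
  rw [ContinuousLinearMap.comp_apply, hP, hT, ContinuousLinearMap.comp_apply]

theorem IsEquivariantOp.sub {m n : ℕ} {T S : BoundedCochain X m →L[ℝ] BoundedCochain Y n}
    (hT : IsEquivariantOp Γ T) (hS : IsEquivariantOp Γ S) : IsEquivariantOp Γ (T - S) :=
  fun γ a => by
  rw [sub_apply, hT, hS, sub_apply,
    ContinuousLinearMap.sub_comp]

/-- The values of `g T g⁻¹` on a fixed cochain and a fixed simplex, as a function of `g`. -/
def conjugates {m n : ℕ} (T : BoundedCochain X m →L[ℝ] BoundedCochain Y n)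
    (σ : SingularSimplex Y n) : BoundedCochain X m →ₗ[ℝ] BoundedFun Γ where
  toFun a := ⟨fun g => T (a.comp (SingularChain.map (smulMap Γ X g) m))
      (SingularChain.simplex (g⁻¹ • σ)), ‖T‖ * ‖a‖, fun g =>
    abs_apply_comp_map_le T _ a _⟩
  map_add' a b := by
    apply Subtype.ext
    funext g
    simp [ContinuousLinearMap.add_comp]
  map_smul' c a := by
    apply Subtype.ext
    funext g
    simp [ContinuousLinearMap.smul_comp]

theorem conjugates_apply {m n : ℕ} (T : BoundedCochain X m →L[ℝ] BoundedCochain Y n)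
    (σ : SingularSimplex Y n) (a : BoundedCochain X m) (g : Γ) :
    (conjugates T σ a).1 g = T (a.comp (SingularChain.map (smulMap Γ X g) m))
      (SingularChain.simplex (g⁻¹ • σ)) := rfl

/-- The average of the conjugates of an operator with respect to a family of means. -/
def average {m n : ℕ} (μ : EquivariantMeans Γ (SingularSimplex Y n))
    (T : BoundedCochain X m →L[ℝ] BoundedCochain Y n) :
    BoundedCochain X m →L[ℝ] BoundedCochain Y n :=
  LinearMap.mkContinuous
    { toFun := fun a => BoundedCochain.ofBounded (fun σ => μ.mean σ (conjugates T σ a)) (‖T‖ * ‖a‖)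
        fun σ => μ.abs_mean_le σ _ _ fun g => abs_apply_comp_map_le T _ a _
      map_add' := fun a b => SingularChain.hom_ext fun σ => by
        rw [add_apply]
        simp only [BoundedCochain.ofBounded_simplex, map_add]
      map_smul' := fun c a => SingularChain.hom_ext fun σ => by
        rw [smul_apply]
        simp only [BoundedCochain.ofBounded_simplex, map_smul, RingHom.id_apply] }
    ‖T‖ fun a => LinearMap.mkContinuous_norm_le _ (by positivity)
      (SingularChain.norm_lift_le _ _ fun σ =>
        μ.abs_mean_le σ _ _ fun g => abs_apply_comp_map_le T _ a _)

theorem average_simplex {m n : ℕ} (μ : EquivariantMeans Γ (SingularSimplex Y n))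
    (T : BoundedCochain X m →L[ℝ] BoundedCochain Y n) (a : BoundedCochain X m)
    (σ : SingularSimplex Y n) :
    average μ T a (SingularChain.simplex σ) = μ.mean σ (conjugates T σ a) :=
  SingularChain.lift_simplex _ σ

/-- Moving the simplex by `γ` translates the mean, which amounts to the substitution `g ↦ γ g`; in
`(γ g)⁻¹ γ σ` the factor `γ` cancels and only `a ∘ γ` remains. -/
theorem isEquivariantOp_average {m n : ℕ} (μ : EquivariantMeans Γ (SingularSimplex Y n))
    (T : BoundedCochain X m →L[ℝ] BoundedCochain Y n) : IsEquivariantOp Γ (average μ T) := by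
  intro γ a
  refine SingularChain.hom_ext fun σ => ?_
  rw [ContinuousLinearMap.comp_apply, SingularChain.map_simplex, average_simplex]
  refine Eq.trans ?_ (average_simplex μ T a (γ • σ)).symm
  rw [μ.mean_smul]
  congr 1
  apply Subtype.ext
  funext g
  change _ = (conjugates T (γ • σ) a).1 (γ * g)
  rw [conjugates_apply, conjugates_apply, ContinuousLinearMap.comp_assoc, map_smulMap_mul,
    mul_inv_rev, mul_smul, inv_smul_smul]

theorem average_simplex_eq {m n : ℕ} (μ : EquivariantMeans Γ (SingularSimplex Y n))
    (T : BoundedCochain X m →L[ℝ] BoundedCochain Y n) (a : BoundedCochain X m)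
    (σ : SingularSimplex Y n) (c : ℝ)
    (h : ∀ g : Γ, T (a.comp (SingularChain.map (smulMap Γ X g) m))
      (SingularChain.simplex (g⁻¹ • σ)) = c) :
    average μ T a (SingularChain.simplex σ) = c := by
  rw [average_simplex]
  exact μ.mean_const σ _ c h

/-- If an operator restricts to an equivariant operator along `P`, then so does its average. -/
theorem average_apply_eq {k m n : ℕ} (μ : EquivariantMeans Γ (SingularSimplex Y n))
    (T : BoundedCochain X m →L[ℝ] BoundedCochain Y n)
    {P : BoundedCochain X k →L[ℝ] BoundedCochain X m}
    {Q : BoundedCochain X k →L[ℝ] BoundedCochain Y n} (hP : IsEquivariantOp Γ P)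
    (hQ : IsEquivariantOp Γ Q) (h : ∀ a, T (P a) = Q a) (a : BoundedCochain X k) :
    average μ T (P a) = Q a := by
  refine SingularChain.hom_ext fun σ => average_simplex_eq μ T _ _ _ fun g => ?_
  -- On the image of `P` every conjugate of `T` has the same value, that of `Q a` at `g g⁻¹ σ = σ`,
  -- and a mean fixes constants.
  rw [← hP, h, hQ, ContinuousLinearMap.comp_apply, SingularChain.map_simplex]
  congr 2
  exact smul_inv_smul g σ

end Operators

/-! ### Equivariant maps between complexes of bounded cochains -/

/-- The constant `0`-cochain with value `1`. -/
def unitCochain (X : Type u) [TopologicalSpace X] : BoundedCochain X 0 :=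
  BoundedCochain.ofBounded (fun _ => 1) 1 (by simp)

theorem unitCochain_simplex {X : Type u} [TopologicalSpace X] (σ : SingularSimplex X 0) :
    unitCochain X (SingularChain.simplex σ) = 1 :=
  BoundedCochain.ofBounded_simplex _ _ _ σ

theorem unitCochain_comp_map {X Y : Type u} [TopologicalSpace X] [TopologicalSpace Y]
    (f : C(X, Y)) : (unitCochain Y).comp (SingularChain.map f 0) = unitCochain X :=
  SingularChain.hom_ext fun σ => by
    rw [ContinuousLinearMap.comp_apply, SingularChain.map_simplex, unitCochain_simplex,
      unitCochain_simplex]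

theorem bdCoboundary_unitCochain (X : Type u) [TopologicalSpace X] :
    bdCoboundary X 0 (unitCochain X) = 0 :=
  SingularChain.hom_ext fun σ => by
    rw [bdCoboundary_apply, ContinuousLinearMap.comp_apply, SingularChain.boundary_simplex]
    simp [unitCochain_simplex]

/-- A contraction of the augmented complex of bounded cochains of `X` by bounded operators, which
need not respect any group action. -/
structure BoundedContraction (X : Type u) [TopologicalSpace X] where
  op (n : ℕ) : BoundedCochain X (n + 1) →L[ℝ] BoundedCochain X n
  augmentation : BoundedCochain X 0 →L[ℝ] ℝ
  -- The unit cochain is unchanged by pullback, so this only normalizes the augmentation; the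
  -- translate by `f` is the form in which conjugates meet it.
  augmentation_unit : ∀ f : C(X, X), augmentation ((unitCochain X).comp (SingularChain.map f 0)) = 1
  op_zero_bdCoboundary (a : BoundedCochain X 0) :
    op 0 (bdCoboundary X 0 a) = a - augmentation a • unitCochain X
  op_succ_bdCoboundary (n : ℕ) (a : BoundedCochain X (n + 1)) :
    op (n + 1) (bdCoboundary X (n + 1) a) = a - bdCoboundary X n (op n a)

section

variable (Γ : Type u) [Group Γ] (X Y Z : Type u)
  [TopologicalSpace X] [TopologicalSpace Y] [TopologicalSpace Z]
  [MulAction Γ X] [MulAction Γ Y] [MulAction Γ Z]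
  [ContinuousConstSMul Γ X] [ContinuousConstSMul Γ Y] [ContinuousConstSMul Γ Z]

/-- An equivariant cochain map between complexes of bounded cochains, by bounded operators. -/
structure EquivariantCochainMap where
  op (n : ℕ) : BoundedCochain X n →L[ℝ] BoundedCochain Y n
  equivariant (n : ℕ) : IsEquivariantOp Γ (op n)
  comm (n : ℕ) (a : BoundedCochain X n) :
    op (n + 1) (bdCoboundary X n a) = bdCoboundary Y n (op n a)

open CategoryTheory

namespace EquivariantCochainMap

variable {Γ X Y Z}

/-- The identity. -/
def id : EquivariantCochainMap Γ X X where
  op _ := ContinuousLinearMap.id ℝ _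
  equivariant _ _ _ := rfl
  comm _ _ := rfl

/-- The composition of equivariant cochain maps. -/
def comp (v : EquivariantCochainMap Γ Y Z) (w : EquivariantCochainMap Γ X Y) :
    EquivariantCochainMap Γ X Z where
  op n := (v.op n).comp (w.op n)
  equivariant n := (v.equivariant n).comp (w.equivariant n)
  comm n a := by
    rw [ContinuousLinearMap.comp_apply, w.comm, v.comm, ContinuousLinearMap.comp_apply]

/-- The difference of equivariant cochain maps. -/
def sub (v w : EquivariantCochainMap Γ X Y) : EquivariantCochainMap Γ X Y where
  op n := v.op n - w.op n
  equivariant n := (v.equivariant n).sub (w.equivariant n)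
  comm n a := by rw [sub_apply, v.comm, w.comm, sub_apply, map_sub]

/-- Pullback along a continuous `Γ`-map. -/
def ofMap (f : C(X, Y)) (hf : IsEquivariant Γ f) : EquivariantCochainMap Γ Y X where
  op n := ContinuousLinearMap.precomp ℝ (SingularChain.map f n)
  equivariant n γ a := by
    change (a.comp _).comp _ = (a.comp _).comp _
    rw [ContinuousLinearMap.comp_assoc, ContinuousLinearMap.comp_assoc, SingularChain.map_comp,
      SingularChain.map_comp]
    congr 2
    ext x
    exact (hf γ x).symm
  comm n a := by
    change (a.comp _).comp _ = (a.comp _).comp _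
    rw [ContinuousLinearMap.comp_assoc, ← SingularChain.map_comp_boundary,
      ContinuousLinearMap.comp_assoc]

/-- The operators of a cochain map that extends the identity of `ℝ`. -/
def extensionOp (k : BoundedContraction X)
    (μ : ∀ n, EquivariantMeans Γ (SingularSimplex Y n)) :
    ∀ n, BoundedCochain X n →L[ℝ] BoundedCochain Y n
  | 0 => average (μ 0) (k.augmentation.smulRight (unitCochain Y))
  | n + 1 => average (μ (n + 1)) ((bdCoboundary Y n).comp ((extensionOp k μ n).comp (k.op n)))

theorem extensionOp_equivariant (k : BoundedContraction X)
    (μ : ∀ n, EquivariantMeans Γ (SingularSimplex Y n)) (n : ℕ) :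
    IsEquivariantOp Γ (extensionOp k μ n) := by
  cases n <;> exact isEquivariantOp_average _ _

theorem extensionOp_unit (k : BoundedContraction X)
    (μ : ∀ n, EquivariantMeans Γ (SingularSimplex Y n)) :
    extensionOp k μ 0 (unitCochain X) = unitCochain Y := by
  refine SingularChain.hom_ext fun σ => average_simplex_eq _ _ _ _ _ fun g => ?_
  rw [ContinuousLinearMap.smulRight_apply, k.augmentation_unit, one_smul, unitCochain_simplex,
    unitCochain_simplex]

/-- By `average_apply_eq` the identity is needed only before averaging. There `k` recovers `b` from
`d b` up to a multiple of the unit cochain or a coboundary, and `d` after the previous operator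
kills this error, in positive degrees by induction and `d d = 0`. -/
theorem extensionOp_comm (k : BoundedContraction X)
    (μ : ∀ n, EquivariantMeans Γ (SingularSimplex Y n)) (n : ℕ) (a : BoundedCochain X n) :
    extensionOp k μ (n + 1) (bdCoboundary X n a) = bdCoboundary Y n (extensionOp k μ n a) := by
  induction n with
  | zero =>
    refine average_apply_eq (Q := (bdCoboundary Y 0).comp (extensionOp k μ 0)) _ _
      (isEquivariantOp_bdCoboundary 0)
      ((isEquivariantOp_bdCoboundary 0).comp (extensionOp_equivariant k μ 0)) (fun b => ?_) a
    simp only [ContinuousLinearMap.comp_apply]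
    rw [k.op_zero_bdCoboundary, map_sub, map_sub, map_smul, map_smul, extensionOp_unit,
      bdCoboundary_unitCochain, smul_zero, sub_zero]
  | succ n ih =>
    refine average_apply_eq (Q := (bdCoboundary Y (n + 1)).comp (extensionOp k μ (n + 1))) _ _
      (isEquivariantOp_bdCoboundary (n + 1))
      ((isEquivariantOp_bdCoboundary (n + 1)).comp (extensionOp_equivariant k μ (n + 1)))
      (fun b => ?_) a
    simp only [ContinuousLinearMap.comp_apply]
    rw [k.op_succ_bdCoboundary, map_sub, map_sub, ih, bdCoboundary_bdCoboundary, sub_zero]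

/-- Extension of the identity of `ℝ` to an equivariant cochain map. -/
def extension (k : BoundedContraction X)
    (μ : ∀ n, EquivariantMeans Γ (SingularSimplex Y n)) : EquivariantCochainMap Γ X Y where
  op := extensionOp k μ
  equivariant := extensionOp_equivariant k μ
  comm := extensionOp_comm k μ

/-- The operators of a null-homotopy. -/
def nullHomotopyOp (w : EquivariantCochainMap Γ X Y) (k : BoundedContraction X)
    (μ : ∀ n, EquivariantMeans Γ (SingularSimplex Y n)) :
    ∀ n, BoundedCochain X (n + 1) →L[ℝ] BoundedCochain Y n
  | 0 => average (μ 0) ((w.op 0).comp (k.op 0))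
  | n + 1 => average (μ (n + 1))
      ((w.op (n + 1) - (bdCoboundary Y n).comp (nullHomotopyOp w k μ n)).comp (k.op (n + 1)))

variable (w : EquivariantCochainMap Γ X Y) (k : BoundedContraction X)
  (μ : ∀ n, EquivariantMeans Γ (SingularSimplex Y n))

theorem nullHomotopyOp_equivariant (n : ℕ) : IsEquivariantOp Γ (nullHomotopyOp w k μ n) := by
  cases n <;> exact isEquivariantOp_average _ _

theorem nullHomotopyOp_zero (hw : w.op 0 (unitCochain X) = 0) (a : BoundedCochain X 0) :
    nullHomotopyOp w k μ 0 (bdCoboundary X 0 a) = w.op 0 a := by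
  refine average_apply_eq _ _ (isEquivariantOp_bdCoboundary 0) (w.equivariant 0) (fun b => ?_) a
  rw [ContinuousLinearMap.comp_apply, k.op_zero_bdCoboundary, map_sub, map_smul, hw, smul_zero,
    sub_zero]

/-- The hypothesis says that `w - d N`, for the homotopy `N` so far, vanishes on coboundaries. It
therefore does not see the error `d (k b)` in `k (d b) = b - d (k b)`. -/
theorem nullHomotopyOp_succ_of_vanish (n : ℕ)
    (h : ∀ b, w.op (n + 1) (bdCoboundary X n b) =
      bdCoboundary Y n (nullHomotopyOp w k μ n (bdCoboundary X n b)))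
    (a : BoundedCochain X (n + 1)) :
    nullHomotopyOp w k μ (n + 1) (bdCoboundary X (n + 1) a) =
      w.op (n + 1) a - bdCoboundary Y n (nullHomotopyOp w k μ n a) := by
  refine average_apply_eq (Q := w.op (n + 1) - (bdCoboundary Y n).comp (nullHomotopyOp w k μ n))
    _ _ (isEquivariantOp_bdCoboundary (n + 1)) ((w.equivariant (n + 1)).sub
      ((isEquivariantOp_bdCoboundary n).comp (nullHomotopyOp_equivariant w k μ n))) (fun b => ?_) a
  simp only [ContinuousLinearMap.comp_apply, sub_apply, k.op_succ_bdCoboundary, map_sub, h]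
  abel

theorem nullHomotopyOp_succ (hw : w.op 0 (unitCochain X) = 0) (n : ℕ)
    (a : BoundedCochain X (n + 1)) :
    nullHomotopyOp w k μ (n + 1) (bdCoboundary X (n + 1) a) =
      w.op (n + 1) a - bdCoboundary Y n (nullHomotopyOp w k μ n a) := by
  induction n with
  | zero =>
    refine nullHomotopyOp_succ_of_vanish w k μ 0 (fun b => ?_) a
    rw [nullHomotopyOp_zero w k μ hw, w.comm]
  | succ n ih =>
    refine nullHomotopyOp_succ_of_vanish w k μ (n + 1) (fun b => ?_) a
    -- Applying `d` to `N d b = w b - d N b` gives `d N d b = d w b = w d b`.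
    rw [ih, map_sub, bdCoboundary_bdCoboundary, w.comm, sub_zero]

/-- Restriction of an equivariant operator to the invariant cochains. -/
def restrictInvariants {m n : ℕ} (T : BoundedCochain X m →L[ℝ] BoundedCochain Y n)
    (hT : IsEquivariantOp Γ T) : invariantCochains Γ X m →ₗ[ℝ] invariantCochains Γ Y n :=
  T.toLinearMap.restrict fun a ha γ => by
    change (T a).comp _ = T a
    rw [← hT, ha γ]

/-- The induced map on the complexes of invariant cochains. -/
def toHom (w : EquivariantCochainMap Γ X Y) : invariantComplex Γ X ⟶ invariantComplex Γ Y :=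
  CochainComplex.ofHom (fun n => ModuleCat.ofHom (restrictInvariants (w.op n) (w.equivariant n)))
    (fun n => by
      rw [invariantComplex_d, invariantComplex_d]
      ext a : 2
      apply Subtype.ext
      exact (w.comm n a.1).symm)

theorem toHom_id : (id : EquivariantCochainMap Γ X X).toHom = 𝟙 _ :=
  rfl

theorem toHom_comp (v : EquivariantCochainMap Γ Y Z) (w : EquivariantCochainMap Γ X Y) :
    (v.comp w).toHom = w.toHom ≫ v.toHom := rfl

theorem toHom_sub (v w : EquivariantCochainMap Γ X Y) :
    (v.sub w).toHom = v.toHom - w.toHom := rfl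

theorem homologyMap_toHom_eq_zero (w : EquivariantCochainMap Γ X Y) (k : BoundedContraction X)
    (μ : ∀ n, EquivariantMeans Γ (SingularSimplex Y n)) (hw : w.op 0 (unitCochain X) = 0) (n : ℕ) :
    HomologicalComplex.homologyMap w.toHom n = 0 := by
  -- The homotopy on invariant cochains. The `eqToHom` only transports along `j + 1 = i` and is the
  -- identity when `i` is literally `j + 1`.
  let h : ∀ i j, (ComplexShape.up ℕ).Rel j i →
      ((invariantComplex Γ X).X i ⟶ (invariantComplex Γ Y).X j) := fun i j hij =>
    eqToHom (congrArg (invariantComplex Γ X).X (show j + 1 = i from hij).symm) ≫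
      ModuleCat.ofHom (restrictInvariants (nullHomotopyOp w k μ j)
        (nullHomotopyOp_equivariant w k μ j))
  have key : w.toHom = Homotopy.nullHomotopicMap' h := by
    ext n : 1
    cases n with
    | zero =>
      rw [Homotopy.nullHomotopicMap'_f_of_not_rel_right (k₁ := 0) (k₀ := 1) rfl (by simp),
        invariantComplex_d]
      ext a : 2
      apply Subtype.ext
      exact (nullHomotopyOp_zero w k μ hw a.1).symm
    | succ n =>
      rw [Homotopy.nullHomotopicMap'_f (k₂ := n) (k₁ := n + 1) (k₀ := n + 2) rfl rfl,
        invariantComplex_d, invariantComplex_d]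
      ext a : 2
      apply Subtype.ext
      exact (eq_sub_iff_add_eq.1 (nullHomotopyOp_succ w k μ hw n a.1)).symm
  rw [key, (Homotopy.nullHomotopy' h).homologyMap_eq, HomologicalComplex.homologyMap_zero]

end EquivariantCochainMap

variable {Γ X Y}

open EquivariantCochainMap in
/-- A `Γ`-map between `Γ`-spaces with contractible bounded cochain complexes and with equivariant
means on simplices induces isomorphisms on the cohomology of invariant bounded cochains. -/
theorem bijective_homologyMap_pullbackMap (kX : BoundedContraction X)
    (kY : BoundedContraction Y) (μX : ∀ n, EquivariantMeans Γ (SingularSimplex X n))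
    (μY : ∀ n, EquivariantMeans Γ (SingularSimplex Y n)) (f : C(X, Y)) (hf : IsEquivariant Γ f)
    (n : ℕ) : Function.Bijective (HomologicalComplex.homologyMap (pullbackMap f hf) n) := by
  let F : EquivariantCochainMap Γ Y X := ofMap f hf
  let G : EquivariantCochainMap Γ X Y := extension kX μY
  have hF : F.op 0 (unitCochain Y) = unitCochain X := unitCochain_comp_map f
  have hG : G.op 0 (unitCochain X) = unitCochain Y := extensionOp_unit kX μY
  -- `F` and `G` preserve the unit cochain, so each composite minus the identity kills it and is
  -- null-homotopic on invariants.
  have h1 := homologyMap_toHom_eq_zero ((F.comp G).sub .id) kX μX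
    (by change F.op 0 (G.op 0 _) - _ = 0; rw [hG, hF]; exact sub_self _) n
  have h2 := homologyMap_toHom_eq_zero ((G.comp F).sub .id) kY μY
    (by change G.op 0 (F.op 0 _) - _ = 0; rw [hF, hG]; exact sub_self _) n
  rw [toHom_sub, HomologicalComplex.homologyMap_sub, sub_eq_zero, toHom_comp, toHom_id,
    HomologicalComplex.homologyMap_comp, HomologicalComplex.homologyMap_id] at h1 h2
  have : IsIso (HomologicalComplex.homologyMap (pullbackMap f hf) n) := ⟨_, h2, h1⟩
  exact ConcreteCategory.bijective_of_isIso _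

end

/-! ### Cones over singular simplices -/

theorem stdSimplex_map_apply_of_injective {m n : ℕ} {f : Fin m → Fin n}
    (hf : Function.Injective f) (y : stdSimplex ℝ (Fin m)) (i : Fin m) :
    stdSimplex.map f y (f i) = y i := by
  classical
  rw [stdSimplex.map_coe, FunOnFinite.linearMap_apply_apply]
  simp [hf.eq_iff, Finset.sum_filter]

theorem stdSimplex_map_apply_of_notMem_range {m n : ℕ} {f : Fin m → Fin n}
    (y : stdSimplex ℝ (Fin m)) (j : Fin n) (hj : ∀ i, f i ≠ j) : stdSimplex.map f y j = 0 := by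
  classical
  rw [stdSimplex.map_coe, FunOnFinite.linearMap_apply_apply]
  simp [hj]

/-- The point with barycentric coordinates `(t, (1 - t) y)`. -/
def stdSimplexJoin (n : ℕ) (p : unitInterval × stdSimplex ℝ (Fin (n + 1))) :
    stdSimplex ℝ (Fin (n + 2)) :=
  ⟨Fin.cons (p.1 : ℝ) fun i => (1 - (p.1 : ℝ)) * p.2 i, by
    constructor
    · intro i
      refine Fin.cases ?_ (fun i => ?_) i
      · exact p.1.2.1
      · exact mul_nonneg (sub_nonneg.2 p.1.2.2) (p.2.2.1 i)
    · rw [Fin.sum_univ_succ]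
      simp only [Fin.cons_zero, Fin.cons_succ]
      rw [← Finset.mul_sum, stdSimplex.sum_eq_one]
      ring⟩

theorem stdSimplexJoin_succ {n : ℕ} (t : unitInterval) (y : stdSimplex ℝ (Fin (n + 1)))
    (i : Fin (n + 1)) : stdSimplexJoin n (t, y) i.succ = (1 - (t : ℝ)) * y i := rfl

theorem continuous_stdSimplexJoin (n : ℕ) : Continuous (stdSimplexJoin n) := by
  refine Continuous.subtype_mk (continuous_pi fun i => ?_) _
  refine Fin.cases ?_ (fun i => ?_) i
  · exact continuous_subtype_val.comp continuous_fst
  · exact (continuous_const.sub (continuous_subtype_val.comp continuous_fst)).mul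
      ((continuous_apply i).comp (continuous_subtype_val.comp continuous_snd))

theorem surjective_stdSimplexJoin (n : ℕ) : Function.Surjective (stdSimplexJoin n) := by
  intro z
  have hsum : z 0 + ∑ i : Fin (n + 1), z i.succ = 1 := by
    rw [← Fin.sum_univ_succ, stdSimplex.sum_eq_one]
  by_cases h : z 0 = 1
  -- At the apex the base coordinate is arbitrary; elsewhere it is obtained by dividing by `1 - z
  -- 0`.
  · refine ⟨(1, stdSimplex.vertex 0), stdSimplex.ext (funext fun i => ?_)⟩
    refine Fin.cases ?_ (fun i => ?_) i
    · exact h.symm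
    · rw [stdSimplexJoin_succ]
      have h0 : ∑ i : Fin (n + 1), z i.succ = 0 := by linarith
      rw [(Finset.sum_eq_zero_iff_of_nonneg fun _ _ => stdSimplex.zero_le z _).1 h0 i
        (Finset.mem_univ i)]
      simp
  · have hpos : 0 < 1 - z 0 :=
      sub_pos.2 (lt_of_le_of_ne (stdSimplex.le_one z 0) h)
    refine ⟨(⟨z 0, stdSimplex.zero_le z 0, stdSimplex.le_one z 0⟩,
      ⟨fun i => z i.succ / (1 - z 0), fun i => div_nonneg (stdSimplex.zero_le z _) hpos.le, ?_⟩),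
      stdSimplex.ext (funext fun i => ?_)⟩
    · rw [← Finset.sum_div, div_eq_one_iff_eq hpos.ne']
      linarith
    · refine Fin.cases rfl (fun i => ?_) i
      rw [stdSimplexJoin_succ]
      exact mul_div_cancel₀ _ hpos.ne'

/-- A continuous surjection from a compact space to a Hausdorff space is closed. Hence maps on the
cylinder that respect the fibres descend continuously to the simplex. -/
theorem isQuotientMap_stdSimplexJoin (n : ℕ) : Topology.IsQuotientMap (stdSimplexJoin n) :=
  (continuous_stdSimplexJoin n).isClosedMap.isQuotientMap (continuous_stdSimplexJoin n)
    (surjective_stdSimplexJoin n)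

/-- The join collapses only the end `t = 1` of the cylinder, where a contraction is constant. -/
theorem stdSimplexJoin_eq {n : ℕ} {t t' : unitInterval} {y y' : stdSimplex ℝ (Fin (n + 1))}
    (h : stdSimplexJoin n (t, y) = stdSimplexJoin n (t', y')) :
    t = t' ∧ (t = 1 ∨ y = y') := by
  have ht : t = t' := Subtype.ext (congrArg (fun z : stdSimplex ℝ (Fin (n + 2)) => z 0) h)
  subst ht
  refine ⟨rfl, or_iff_not_imp_left.2 fun h1 => stdSimplex.ext (funext fun i => ?_)⟩
  have hi := congrArg (fun z : stdSimplex ℝ (Fin (n + 2)) => z i.succ) h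
  simp only [stdSimplexJoin_succ] at hi
  exact mul_left_cancel₀ (sub_ne_zero.2 fun h2 => h1 (Subtype.ext h2.symm)) hi

theorem stdSimplex_map_succAbove_zero {n : ℕ} (y : stdSimplex ℝ (Fin (n + 1))) :
    stdSimplex.map (Fin.succAbove 0) y = stdSimplexJoin n (0, y) := by
  refine stdSimplex.ext (funext fun i => ?_)
  refine Fin.cases ?_ (fun i => ?_) i
  · rw [stdSimplex_map_apply_of_notMem_range y 0 fun i => Fin.succAbove_ne 0 i]
    rfl
  · rw [← Fin.succAbove_zero_apply, stdSimplex_map_apply_of_injective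
      Fin.succAbove_right_injective, Fin.succAbove_zero_apply, stdSimplexJoin_succ]
    simp

theorem stdSimplex_map_succAbove_succ {n : ℕ} (i : Fin (n + 2)) (t : unitInterval)
    (y : stdSimplex ℝ (Fin (n + 1))) :
    stdSimplex.map i.succ.succAbove (stdSimplexJoin n (t, y)) =
      stdSimplexJoin (n + 1) (t, stdSimplex.map i.succAbove y) := by
  refine stdSimplex.ext (funext fun j => ?_)
  rcases Fin.eq_self_or_eq_succAbove i.succ j with rfl | ⟨j, rfl⟩
  · rw [stdSimplex_map_apply_of_notMem_range _ _ fun k => Fin.succAbove_ne _ k,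
      stdSimplexJoin_succ, stdSimplex_map_apply_of_notMem_range _ _ fun k => Fin.succAbove_ne _ k,
      mul_zero]
  · rw [stdSimplex_map_apply_of_injective Fin.succAbove_right_injective]
    refine Fin.cases ?_ (fun j => ?_) j
    · rw [Fin.succ_succAbove_zero]
      rfl
    · rw [Fin.succ_succAbove_succ, stdSimplexJoin_succ, stdSimplexJoin_succ,
        stdSimplex_map_apply_of_injective Fin.succAbove_right_injective]

theorem stdSimplex_map_succAbove_one (y : stdSimplex ℝ (Fin 1)) :
    stdSimplex.map (Fin.succAbove (1 : Fin 2)) y = stdSimplexJoin 0 (1, y) := by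
  have hy : y 0 = 1 := by simp
  refine stdSimplex.ext (funext fun j => ?_)
  fin_cases j
  · exact (stdSimplex_map_apply_of_injective
      (Fin.succAbove_right_injective (p := (1 : Fin 2))) y 0).trans hy
  · refine (stdSimplex_map_apply_of_notMem_range y 1 fun k => Fin.succAbove_ne _ k).trans ?_
    change (0 : ℝ) = (1 - 1) * y 0
    ring

/-! ### The cone operator of a contractible space -/

section Cone

variable {X : Type u} [TopologicalSpace X] {x₀ : X}
  (H : (ContinuousMap.id X).Homotopy (ContinuousMap.const X x₀))

/-- A contraction of the space, applied to a singular simplex. -/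
def SingularSimplex.contraction {n : ℕ} (σ : SingularSimplex X n) :
    C(unitInterval × stdSimplex ℝ (Fin (n + 1)), X) :=
  H.toContinuousMap.comp ((ContinuousMap.id unitInterval).prodMap σ)

theorem SingularSimplex.contraction_apply {n : ℕ} (σ : SingularSimplex X n) (t : unitInterval)
    (y : stdSimplex ℝ (Fin (n + 1))) : σ.contraction H (t, y) = H (t, σ y) := rfl

theorem SingularSimplex.contraction_eq {n : ℕ} (σ : SingularSimplex X n)
    (p q : unitInterval × stdSimplex ℝ (Fin (n + 1)))
    (h : stdSimplexJoin n p = stdSimplexJoin n q) : σ.contraction H p = σ.contraction H q := by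
  obtain ⟨t, y⟩ := p
  obtain ⟨t', y'⟩ := q
  obtain ⟨rfl, rfl | rfl⟩ := stdSimplexJoin_eq h
  · rw [contraction_apply, contraction_apply, H.apply_one, H.apply_one]
    rfl
  · rfl

/-- The cone over a singular simplex along a contraction of the space. -/
def SingularSimplex.cone {n : ℕ} (σ : SingularSimplex X n) : SingularSimplex X (n + 1) :=
  Topology.IsQuotientMap.lift (f := ⟨stdSimplexJoin n, continuous_stdSimplexJoin n⟩)
    (isQuotientMap_stdSimplexJoin n) (σ.contraction H) (σ.contraction_eq H)

theorem SingularSimplex.cone_join {n : ℕ} (σ : SingularSimplex X n) (t : unitInterval)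
    (y : stdSimplex ℝ (Fin (n + 1))) : σ.cone H (stdSimplexJoin n (t, y)) = H (t, σ y) :=
  DFunLike.congr_fun (Topology.IsQuotientMap.lift_comp
    (f := ⟨stdSimplexJoin n, continuous_stdSimplexJoin n⟩)
    (isQuotientMap_stdSimplexJoin n) (σ.contraction H) (σ.contraction_eq H)) (t, y)

theorem SingularSimplex.face_zero_cone {n : ℕ} (σ : SingularSimplex X n) :
    (σ.cone H).face 0 = σ := by
  ext y
  change σ.cone H (stdSimplex.map (Fin.succAbove 0) y) = σ y
  rw [stdSimplex_map_succAbove_zero, cone_join]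
  exact H.apply_zero _

theorem SingularSimplex.face_succ_cone {n : ℕ} (σ : SingularSimplex X (n + 1)) (i : Fin (n + 2)) :
    (σ.cone H).face i.succ = (σ.face i).cone H := by
  ext z
  obtain ⟨⟨t, y⟩, rfl⟩ := surjective_stdSimplexJoin n z
  change σ.cone H (stdSimplex.map i.succ.succAbove _) = _
  rw [stdSimplex_map_succAbove_succ, cone_join, cone_join]
  rfl

theorem SingularSimplex.face_one_cone (σ : SingularSimplex X 0) :
    (σ.cone H).face 1 = ContinuousMap.const _ x₀ := by
  ext y
  change σ.cone H (stdSimplex.map (Fin.succAbove 1) y) = x₀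
  rw [stdSimplex_map_succAbove_one, cone_join]
  exact H.apply_one _

/-- The cone operator on singular chains. -/
def SingularChain.cone (n : ℕ) : SingularChain X n →L[ℝ] SingularChain X (n + 1) :=
  (lift fun σ => simplex (σ.cone H)).mkContinuous 1
    (norm_lift_le _ _ fun _ => (norm_simplex _).le)

theorem SingularChain.cone_simplex {n : ℕ} (σ : SingularSimplex X n) :
    cone H n (simplex σ) = simplex (σ.cone H) :=
  lift_simplex _ σ

theorem SingularChain.boundary_cone_zero (σ : SingularSimplex X 0) :
    boundary X 0 (cone H 0 (simplex σ)) =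
      simplex σ - simplex (ContinuousMap.const _ x₀) := by
  rw [cone_simplex, boundary_simplex, Fin.sum_univ_two, σ.face_zero_cone H, σ.face_one_cone H]
  simp [sub_eq_add_neg]

/-- Face `0` of the cone is its base `σ`. The other faces are cones over the faces of `σ` with index
shifted by one, which accounts for the minus sign. -/
theorem SingularChain.boundary_cone_succ {n : ℕ} (σ : SingularSimplex X (n + 1)) :
    boundary X (n + 1) (cone H (n + 1) (simplex σ)) =
      simplex σ - cone H n (boundary X n (simplex σ)) := by
  rw [cone_simplex, boundary_simplex, Fin.sum_univ_succ, σ.face_zero_cone H, boundary_simplex,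
    map_sum, sub_eq_add_neg, ← Finset.sum_neg_distrib]
  simp only [σ.face_succ_cone H, map_smul, cone_simplex, Fin.val_succ, pow_succ, mul_neg, mul_one,
    neg_smul, Fin.val_zero, pow_zero, one_smul]

/-- A contraction of a space induces a contraction of its complex of bounded cochains. -/
def BoundedContraction.ofHomotopy : BoundedContraction X where
  op n := ContinuousLinearMap.precomp ℝ (SingularChain.cone H n)
  augmentation := ContinuousLinearMap.apply ℝ ℝ (SingularChain.simplex (ContinuousMap.const _ x₀))
  augmentation_unit f := by
    rw [unitCochain_comp_map]
    exact unitCochain_simplex _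
  op_zero_bdCoboundary a := SingularChain.hom_ext fun σ => by
    change a (SingularChain.boundary X 0 (SingularChain.cone H 0 (SingularChain.simplex σ))) = _
    rw [SingularChain.boundary_cone_zero, map_sub, sub_apply, smul_apply, unitCochain_simplex,
      smul_eq_mul, mul_one]
    rfl
  op_succ_bdCoboundary n a := SingularChain.hom_ext fun σ => by
    change a (SingularChain.boundary X _ (SingularChain.cone H _ (SingularChain.simplex σ))) = _
    rw [SingularChain.boundary_cone_succ, map_sub]
    rfl

end Cone

/-! ### Free `Γ`-spaces -/

/-- The space `Γ × Z` with `Γ` discrete and acting by left multiplication on the first factor. -/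
def FreeSpace (Γ Z : Type u) : Type u := Σ _ : Γ, Z

namespace FreeSpace

open Topology Set Metric

variable (Γ Z : Type u)

instance [Group Γ] : MulAction Γ (FreeSpace Γ Z) where
  smul γ p := ⟨γ * p.1, p.2⟩
  one_smul p := Sigma.ext (one_mul p.1) HEq.rfl
  mul_smul γ γ' p := Sigma.ext (mul_assoc γ γ' p.1) HEq.rfl

variable {Γ Z}

/-- The point `(g, z)`. -/
def mk (g : Γ) (z : Z) : FreeSpace Γ Z := ⟨g, z⟩

theorem mk_injective (g : Γ) : Function.Injective (mk g : Z → FreeSpace Γ Z) :=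
  sigma_mk_injective (β := fun _ : Γ => Z)

theorem eq_one_of_smul_eq [Group Γ] (γ : Γ) (p : FreeSpace Γ Z) (h : (γ • p).1 = p.1) : γ = 1 :=
  mul_eq_right.1 h

theorem stabilizer_eq_bot [Group Γ] (p : FreeSpace Γ Z) : MulAction.stabilizer Γ p = ⊥ :=
  (Subgroup.eq_bot_iff_forall _).2 fun γ hγ => eq_one_of_smul_eq γ p (congrArg Sigma.fst hγ)

variable [TopologicalSpace Z]

instance : TopologicalSpace (FreeSpace Γ Z) := inferInstanceAs (TopologicalSpace (Σ _ : Γ, Z))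

instance [T2Space Z] : T2Space (FreeSpace Γ Z) := inferInstanceAs (T2Space (Σ _ : Γ, Z))

instance [Group Γ] : ContinuousConstSMul Γ (FreeSpace Γ Z) where
  continuous_const_smul γ := continuous_sigma fun g =>
    continuous_sigmaMk (σ := fun _ : Γ => Z) (i := γ * g)

theorem continuous_mk (g : Γ) : Continuous (mk g : Z → FreeSpace Γ Z) :=
  continuous_sigmaMk (σ := fun _ : Γ => Z)

theorem continuous_snd : Continuous (fun p : FreeSpace Γ Z => p.2) :=
  continuous_sigma fun _ => continuous_id

variable [Group Γ]

/-- The product cell structure. -/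
@[reducible] def cwComplex (c : CWComplex (univ : Set Z)) :
    CWComplex (univ : Set (FreeSpace Γ Z)) where
  cell n := Γ × c.cell n
  map n i :=
    { toFun := fun x => mk i.1 (c.map n i.2 x)
      invFun := fun p => (c.map n i.2).symm p.2
      source := (c.map n i.2).source
      target := mk i.1 '' (c.map n i.2).target
      map_source' := fun x hx => mem_image_of_mem _ ((c.map n i.2).map_source hx)
      map_target' := by
        rintro _ ⟨z, hz, rfl⟩
        exact (c.map n i.2).map_target hz
      left_inv' := fun x hx => (c.map n i.2).left_inv hx
      right_inv' := by
        rintro _ ⟨z, hz, rfl⟩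
        exact congrArg (mk i.1) ((c.map n i.2).right_inv hz) }
  source_eq n i := c.source_eq n i.2
  continuousOn n i := (continuous_mk i.1).comp_continuousOn (c.continuousOn n i.2)
  continuousOn_symm n i := (c.continuousOn_symm n i.2).comp continuous_snd.continuousOn (by
    rintro _ ⟨z, hz, rfl⟩
    exact hz)
  pairwiseDisjoint' := by
    rintro ⟨n, g, i⟩ - ⟨m, g', j⟩ - hne
    rw [Function.onFun, Set.disjoint_left]
    rintro _ ⟨x, hx, rfl⟩ ⟨y, hy, hxy⟩
    obtain rfl : g' = g := congrArg Sigma.fst hxy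
    have hxy' : c.map m j y = c.map n i x := mk_injective g' hxy
    have hne' : (⟨n, i⟩ : Σ n, c.cell n) ≠ ⟨m, j⟩ := fun h => hne (by cases h; rfl)
    exact Set.disjoint_left.1 (c.pairwiseDisjoint' (mem_univ _) (mem_univ _) hne')
      ⟨x, hx, rfl⟩ ⟨y, hy, hxy'⟩
  mapsTo' n i := by
    obtain ⟨I, hI⟩ := c.mapsTo' n i.2
    refine ⟨fun m => (I m).map ⟨Prod.mk i.1, Prod.mk_right_injective i.1⟩, fun x hx => ?_⟩
    have h := hI hx
    simp only [mem_iUnion] at h ⊢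
    obtain ⟨m, hm, j, hj, y, hy, hxy⟩ := h
    exact ⟨m, hm, (i.1, j), Finset.mem_map_of_mem _ hj, y, hy, congrArg (mk i.1) hxy⟩
  closed' A _ hA := by
    -- Closedness is tested on each slice `{g} × Z`, where the closed cell `(g, j)` restricts to the
    -- closed cell `j` of `Z`.
    refine isClosed_sigma_iff.2 fun g => c.closed' _ (subset_univ _) fun n j => ?_
    have h := (hA n (g, j)).preimage (continuous_mk g)
    rw [preimage_inter] at h
    refine Eq.subst (motive := IsClosed) (congrArg (fun B => mk g ⁻¹' A ∩ B) (Set.ext fun z => ?_)) h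
    constructor
    · rintro ⟨x, hx, h⟩
      exact ⟨x, hx, mk_injective g h⟩
    · rintro ⟨x, hx, rfl⟩
      exact ⟨x, hx, rfl⟩
  union' := by
    refine eq_univ_of_forall fun p => ?_
    have h : p.2 ∈ ⋃ (n : ℕ) (j : c.cell n), c.map n j '' closedBall 0 1 := by
      rw [c.union']
      exact mem_univ _
    simp only [mem_iUnion] at h ⊢
    obtain ⟨n, j, x, hx, hxp⟩ := h
    exact ⟨n, (p.1, j), x, hx, congrArg (mk p.1) hxp⟩

/-- Each cell lies in one slice, so a group element preserving it fixes the `Γ`-coordinate and is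
trivial. No action on `Z` enters, so any CW-complex is allowed. -/
theorem isGammaCW [T2Space Z] (c : CWComplex (univ : Set Z)) : IsGammaCW Γ (FreeSpace Γ Z) := by
  refine ⟨inferInstance, inferInstance, cwComplex c, fun γ n i => ⟨(γ * i.1, i.2), ?_⟩,
    fun γ n i h x hx => ?_⟩
  · exact image_image _ _ _
  · have h1 : γ • x ∈ @RelCWComplex.openCell _ _ _ _
        (@CWComplex.instRelCWComplex _ _ _ (cwComplex (Γ := Γ) c)) n i := h ▸ mem_image_of_mem _ hx
    obtain ⟨y, -, hy⟩ := hx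
    obtain ⟨z, -, hz⟩ := h1
    have h2 : (γ • x).1 = x.1 := by
      rw [← hz, ← hy]
      rfl
    rw [eq_one_of_smul_eq γ x h2, one_smul]

/-- The `Γ`-map that extends a continuous map `Z → X`. -/
def extend {X : Type u} [TopologicalSpace X] [MulAction Γ X] [ContinuousConstSMul Γ X]
    (f : C(Z, X)) : C(FreeSpace Γ Z, X) :=
  ⟨fun p => p.1 • f p.2, continuous_sigma fun g => (map_continuous f).const_smul g⟩

theorem isEquivariant_extend {X : Type u} [TopologicalSpace X] [MulAction Γ X]
    [ContinuousConstSMul Γ X] (f : C(Z, X)) : IsEquivariant Γ (extend (Γ := Γ) f) :=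
  fun γ p => mul_smul γ p.1 (f p.2)

theorem extend_mk_one {X : Type u} [TopologicalSpace X] [MulAction Γ X]
    [ContinuousConstSMul Γ X] (f : C(Z, X)) :
    (extend (Γ := Γ) f).comp ⟨mk 1, continuous_mk 1⟩ = f :=
  ContinuousMap.ext fun z => one_smul Γ (f z)

end FreeSpace

/-! ### Classifying spaces -/

section Classifying

variable {Γ : Type u} [Group Γ] {F : SubgroupFamily Γ} {X : Type u} [TopologicalSpace X]
  [MulAction Γ X]

/-- The free orbit `Γ × pt` has isotropy in `F`, so it maps to `X`. -/
theorem IsClassifyingSpace.nonempty (hF : ⊥ ∈ F.carrier) (hX : IsClassifyingSpace F X) :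
    Nonempty X := by
  have c : Topology.CWComplex (Set.univ : Set PUnit.{u + 1}) :=
    Topology.CWComplex.OfDiscreteClosed ⟨inferInstance⟩ isClosed_univ
  obtain ⟨⟨f, -⟩, -⟩ := hX.2.2 (FreeSpace Γ PUnit.{u + 1}) (FreeSpace.isGammaCW c)
    (fun p => by rwa [FreeSpace.stabilizer_eq_bot])
  exact ⟨f (FreeSpace.mk 1 PUnit.unit)⟩

/-- Classifying spaces are (non-equivariantly) contractible. -/
theorem IsClassifyingSpace.homotopic_const (hF : ⊥ ∈ F.carrier) (hX : IsClassifyingSpace F X)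
    (x₀ : X) : (ContinuousMap.id X).Homotopic (ContinuousMap.const X x₀) := by
  obtain ⟨⟨_, _, c, -⟩, -, huniv⟩ := hX
  obtain ⟨H⟩ := (huniv (FreeSpace Γ X) (FreeSpace.isGammaCW c)
    (fun p => by rwa [FreeSpace.stabilizer_eq_bot])).2 _ _
    (FreeSpace.isEquivariant_extend (ContinuousMap.id X))
    (FreeSpace.isEquivariant_extend (ContinuousMap.const X x₀))
  -- Restricting the `Γ`-homotopy to the slice `{1} × X` recovers the two original maps.
  have h := ContinuousMap.Homotopic.comp ⟨H.toHomotopy⟩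
    (ContinuousMap.Homotopic.refl (⟨FreeSpace.mk (1 : Γ), FreeSpace.continuous_mk 1⟩ : C(X, _)))
  rwa [FreeSpace.extend_mk_one, FreeSpace.extend_mk_one] at h

theorem IsClassifyingSpace.nonempty_boundedContraction (hF : ⊥ ∈ F.carrier)
    (hX : IsClassifyingSpace F X) : Nonempty (BoundedContraction X) := by
  obtain ⟨x₀⟩ := hX.nonempty hF
  obtain ⟨H⟩ := hX.homotopic_const hF x₀
  exact ⟨BoundedContraction.ofHomotopy H⟩

/-- An element fixing `σ` fixes every point of its image, so the stabilizer of `σ` lies in that of a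
vertex and is in `F`, hence amenable. -/
theorem HasRestrictedIsotropy.nonempty_equivariantMeans [ContinuousConstSMul Γ X]
    (hF : ∀ K ∈ F.carrier, IsAmenable K) (hX : HasRestrictedIsotropy F X) (n : ℕ) :
    Nonempty (EquivariantMeans Γ (SingularSimplex X n)) := by
  refine EquivariantMeans.nonempty_of_isAmenable fun σ => hF _ ?_
  refine F.subgroup_mem _ (hX (σ (stdSimplex.vertex 0))) _ fun γ hγ => ?_
  exact DFunLike.congr_fun (show γ • σ = σ from hγ) (stdSimplex.vertex 0)

theorem isAmenable_bot : IsAmenable (⊥ : Subgroup Γ) :=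
  ⟨{ toFun := fun f => f.1 1, map_add' := fun _ _ => rfl, map_smul' := fun _ _ => rfl }, rfl,
    fun _ hf => hf 1, fun g f => congrArg f.1 (Subsingleton.elim (g * 1) 1)⟩

end Classifying

end BddCoh

end

theorem mainTheorem5 (Γ : Type*) [Group Γ] :
    BddCoh.IsStronglyAdmissible (BddCoh.amenableFamily Γ) := by
  intro E E' _ _ _ _ _ _ hE hE' f hf n
  obtain ⟨kE⟩ := hE.nonempty_boundedContraction (Set.mem_singleton _)
  obtain ⟨kE'⟩ := hE'.nonempty_boundedContraction
    (show ⊥ ∈ (BddCoh.amenableFamily Γ).carrier from BddCoh.isAmenable_bot)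
  have μE : ∀ n, BddCoh.EquivariantMeans Γ (BddCoh.SingularSimplex E n) := fun n =>
    (hE.2.1.nonempty_equivariantMeans
      (by rintro K rfl; exact BddCoh.isAmenable_bot) n).some
  have μE' : ∀ n, BddCoh.EquivariantMeans Γ (BddCoh.SingularSimplex E' n) := fun n =>
    (BddCoh.HasRestrictedIsotropy.nonempty_equivariantMeans (F := BddCoh.amenableFamily Γ)
      (fun _ h => h) hE'.2.1 n).some
  exact BddCoh.bijective_homologyMap_pullbackMap kE kE' μE μE' f hf n
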